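/- For a real number $\beta>1$, let $T_{-\beta}$ be the $(-\beta)$-transformation of the interval $I_\beta=\big[\tfrac{-\beta}{\beta+1},\tfrac{1}{\beta+1}\big)$ into itself, $T_{-\beta}(x)=-\beta x-\big\lfloor\tfrac{\beta}{\beta+1}-\beta x\big\rfloor$. The $(-\beta)$-expansion of $x\in I_\beta$ is the sequence of integers $d_1d_2d_3\cdots$ with $d_n=\big\lfloor\tfrac{\beta}{\beta+1}-\beta\,T_{-\beta}^{\,n-1}(x)\big\rfloor$ for $n\ge 1$. The set of $(-\beta)$-integers is $$\mathbb{Z}_{-\beta}=\bigcup_{n\ge 0}(-\beta)^n\,T_{-\beta}^{-n}(0),$$ where $T_{-\beta}^{-n}(0)=\{y\in I_\beta : T_{-\beta}^{\,n}(y)=0\}$. A set $S\subset\mathbb{R}$ is uniformly discrete if there is $r>0$ such that each interval of length $r$ contains at most one point of $S$. **Proposition.** Let $a_1a_2\cdots=3\,0\,1\,0^3\,1\,0^5\,1\,0^7\,1\cdots$, that is, the digit $3$ followed by the blocks $0^{2k-1}1$ for $k=1,2,3,\ldots$. Then there is a real number $\beta>1$ such that $a_1a_2\cdots$ is the $(-\beta)$-expansion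 of $\tfrac{-\beta}{\beta+1}$ and $\mathbb{Z}_{-\beta}$ is not uniformly discrete; moreover, for this $\beta$ and every $\varepsilon>0$ there are consecutive elements $x<y$ of $\mathbb{Z}_{-\beta}$ (that is, $x,y\in\mathbb{Z}_{-\beta}$ and no element of $\mathbb{Z}_{-\beta}$ lies strictly between them) with $y-x<\varepsilon$. -/

import Mathlib

/-- The domain `[-β/(β+1), 1/(β+1))` of the `(-β)`-transformation. -/
def negBetaDomain (β : ℝ) : Set ℝ := Set.Ico (-β / (β + 1)) (1 / (β + 1))

/-- The `(-β)`-transformation `x ↦ -β x - ⌊β/(β+1) - β x⌋`. The formula makes sense for every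
real `x` and takes values in `negBetaDomain β`; only its restriction to that domain is used. -/
noncomputable def negBetaTransform (β : ℝ) (x : ℝ) : ℝ :=
  -β * x - (⌊β / (β + 1) - β * x⌋ : ℝ)

/-- The set `ℤ_{-β} = ⋃ n, (-β)^n T⁻ⁿ(0)` of `(-β)`-integers, the preimages being taken in the
domain of the `(-β)`-transformation `T`. -/
def negBetaIntegers (β : ℝ) : Set ℝ :=
  ⋃ n : ℕ, (fun y : ℝ => (-β) ^ n * y) ''
    {y : ℝ | y ∈ negBetaDomain β ∧ (negBetaTransform β)^[n] y = 0}

/-- The `(-β)`-expansion of a point `x` of `negBetaDomain β`: the sequence of digits `d₁ d₂ ⋯`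
with `d_{n+1} = ⌊β/(β+1) - β Tⁿ(x)⌋`. It is indexed from zero: the value at `n` is `d_{n+1}`. -/
noncomputable def negBetaExpansion (β : ℝ) (x : ℝ) : ℕ → ℤ :=
  fun n => ⌊β / (β + 1) - β * (negBetaTransform β)^[n] x⌋

/-- The sequence `3 0 1 0³ 1 0⁵ 1 0⁷ 1 ⋯`, indexed from zero: after the initial `3`, the digit `1`
stands exactly at the indices `k(k+1)` with `k ≥ 1`, because the block `0^{2k-1} 1` has length
`2k` and `2 + 4 + ⋯ + 2k = k(k+1)`. -/
def growingGapDigits : ℕ → ℤ :=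
  fun n => if n = 0 then 3 else if ∃ k ≤ n, n = k * (k + 1) then 1 else 0

/-- A set of reals is uniformly discrete if, for some `r > 0`, each interval of length `r`
contains at most one of its points. -/
def IsUniformlyDiscrete (S : Set ℝ) : Prop :=
  ∃ r : ℝ, 0 < r ∧ ∀ c : ℝ, (S ∩ Set.Icc c (c + r)).Subsingleton

/-- `x < y` are consecutive elements of `S`. -/
def AreConsecutive (S : Set ℝ) (x y : ℝ) : Prop :=
  x ∈ S ∧ y ∈ S ∧ x < y ∧ ∀ z ∈ S, ¬(x < z ∧ z < y)

/-!
Write `q = 1/β`, let `a = a₀ a₁ ⋯` be the sequence `3 0 1 0³ 1 0⁵ 1 ⋯`, and let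
`tₙ = ∑ⱼ a_{n+j} (-q)^{j+1}` be the value of its `n`-th tail, so that `tₙ₊₁ = -β tₙ - aₙ`.
The base `β` is a solution of `t₀ = ℓ`, where `ℓ = -β/(β+1)`; the intermediate value theorem
gives one with `3 ≤ β ≤ 4` (`exists_digitTail_zero_eq`). As the digits after the first are `0` or
`1`, the tails with `n ≥ 1` lie in `[-3/8, 1/8]`, well inside the domain `[ℓ, ℓ + 1)`
(`growingGap_tail_mem_Icc`). Hence the `tₙ` are the orbit of `ℓ`, and `a` is its expansion.

The long runs of zeros in `a` make the orbit of `ℓ` come close to `0`: for `n = k(k+1) + 1` the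
number `tₙ` is positive and at most `2 q^{2k+2}` (`growingGap_tail_after_one`). Since `n` is odd,
the point `s = ℓ - (-q)ⁿ tₙ`, the value of the first `n` digits of `a`, lies slightly to the right
of `ℓ`, and the map `Tⁿ` sends it to `0`. The two points on either side of a
discontinuity of `T` that lead to `s`, namely `-q (1 + s)` (digit `1`, then those of `s`) and
`(-q)² s` (digits `0 0`, then those of `s`), are both sent to `0` by `T^{n+2}`. After
multiplication by `(-β)^{n+2}` they become
`(-β)`-integers whose distance is `(β + 1) tₙ`, which is positive and arbitrarily small
(`exists_negBetaIntegers_close`).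

Finally `ℤ_{-β}` is locally finite (`finite_negBetaIntegers_inter_Icc`): a bounded
interval meets only finitely many levels `(-β)^N T^{-N}(0)` in new points, and each level is
finite. So between two close elements there are consecutive ones.
-/

/-! ### The `(-β)`-transformation -/

/-- If `-β x - d` lies in the domain for an integer `d`, then `d` is the digit of `x`. -/
theorem floor_eq_of_mem_negBetaDomain {β x y : ℝ} {d : ℤ} (hβ : 0 < β)
    (hy : y ∈ negBetaDomain β) (h : y = -β * x - d) : ⌊β / (β + 1) - β * x⌋ = d := by
  have h1 : 1 / (β + 1) = 1 - β / (β + 1) := by field_simp; ring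
  obtain ⟨h2, h3⟩ := hy
  rw [neg_div] at h2
  rw [h1] at h3
  rw [Int.floor_eq_iff]
  constructor <;> linarith

theorem negBetaTransform_eq_of_mem {β x y : ℝ} {d : ℤ} (hβ : 0 < β)
    (hy : y ∈ negBetaDomain β) (h : y = -β * x - d) : negBetaTransform β x = y := by
  rw [negBetaTransform, floor_eq_of_mem_negBetaDomain hβ hy h, h]

theorem negBetaTransform_mem {β : ℝ} (hβ : 0 < β) (x : ℝ) :
    negBetaTransform β x ∈ negBetaDomain β := by
  have h1 : 1 / (β + 1) = 1 - β / (β + 1) := by field_simp; ring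
  have h2 := Int.floor_le (β / (β + 1) - β * x)
  have h3 := Int.lt_floor_add_one (β / (β + 1) - β * x)
  rw [negBetaTransform, negBetaDomain, h1, neg_div]
  constructor <;> linarith

/-- A finite sequence in the domain that follows the recursion `v (i+1) = -β v i - d i` with
integers `d i` is an orbit of the `(-β)`-transformation. -/
theorem iterate_negBetaTransform_eq {β : ℝ} (hβ : 0 < β) {v : ℕ → ℝ} {d : ℕ → ℤ} {n : ℕ}
    (hv : ∀ i, 1 ≤ i → i ≤ n → v i ∈ negBetaDomain β)
    (h : ∀ i < n, v (i + 1) = -β * v i - d i) :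
    (negBetaTransform β)^[n] (v 0) = v n := by
  induction n with
  | zero => rfl
  | succ n ih =>
    rw [Function.iterate_succ_apply',
      ih (fun i h1 h2 => hv i h1 (by omega)) fun i hi => h i (by omega)]
    exact negBetaTransform_eq_of_mem hβ (hv _ (by omega) le_rfl) (h n (by omega))

/-! ### Local finiteness of the `(-β)`-integers -/

theorem finite_iterate_negBetaTransform_eq_zero {β : ℝ} (hβ : 1 < β) (n : ℕ) :
    {y : ℝ | y ∈ negBetaDomain β ∧ (negBetaTransform β)^[n] y = 0}.Finite := by
  induction n with
  | zero => exact (Set.finite_singleton (0 : ℝ)).subset fun y hy => hy.2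
  | succ n ih =>
    -- A preimage of `c` has the form `-(c + d)/β`, with only finitely many possible digits `d`.
    refine ((ih.prod (Set.finite_Icc (0 : ℤ) ⌊β + 1⌋)).image
      fun p : ℝ × ℤ => -(p.1 + p.2) / β).subset ?_
    rintro y ⟨⟨hy1, hy2⟩, hy⟩
    rw [Function.iterate_succ_apply] at hy
    refine ⟨(negBetaTransform β y, ⌊β / (β + 1) - β * y⌋),
      ⟨⟨negBetaTransform_mem (by linarith) y, hy⟩, ?_, ?_⟩, ?_⟩
    · apply Int.floor_nonneg.2
      have : β * y ≤ β * (1 / (β + 1)) := by gcongr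
      rw [mul_one_div] at this
      linarith
    · apply Int.floor_le_floor
      have h1 : β / (β + 1) ≤ 1 := by rw [div_le_one (by linarith)]; linarith
      have h2 : -1 ≤ y := by rw [neg_div] at hy1; linarith
      nlinarith
    · simp only [negBetaTransform]
      have : β ≠ 0 := by linarith
      field_simp
      ring

/-- An element `z` of the level `(-β)^n T^{-n}(0)` belongs to every lower level
`(-β)^N T^{-N}(0)` for which `z / β^N` is small enough, because
`T (z / (-β)^(k+1)) = z / (-β)^k` as soon as the right-hand side lies in the domain. -/
theorem iterate_negBetaTransform_eq_zero_of_le {β : ℝ} (hβ : 1 < β) {z : ℝ} {n N : ℕ}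
    (hNn : N ≤ n) (hz : (negBetaTransform β)^[n] (z / (-β) ^ n) = 0)
    (hN : |z| / β ^ N < 1 / (β + 1)) :
    z / (-β) ^ N ∈ negBetaDomain β ∧ (negBetaTransform β)^[N] (z / (-β) ^ N) = 0 := by
  have hb : -β ≠ 0 := by linarith
  have hdom : ∀ k, N ≤ k → z / (-β) ^ k ∈ negBetaDomain β := by
    intro k hk
    have h1 : |z / (-β) ^ k| < 1 / (β + 1) := by
      rw [abs_div, abs_pow, abs_neg, abs_of_pos (by linarith : 0 < β)]
      refine lt_of_le_of_lt ?_ hN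
      gcongr
      exact hβ.le
    rw [abs_lt] at h1
    refine ⟨le_trans ?_ h1.1.le, h1.2⟩
    rw [neg_div]
    gcongr
  refine ⟨hdom N le_rfl, ?_⟩
  rw [← hz]
  clear hz
  induction n, hNn using Nat.le_induction with
  | base => rfl
  | succ k hk ih =>
    rw [Function.iterate_succ_apply, negBetaTransform_eq_of_mem (d := 0) (by linarith)
      (hdom k hk), ih]
    rw [pow_succ]
    field_simp
    simp

/-- On `[-R, R]` the levels above a suitable `N` contribute nothing new, so that the
`(-β)`-integers there lie in finitely many finite levels. -/
theorem finite_negBetaIntegers_inter_Icc {β : ℝ} (hβ : 1 < β) (R : ℝ) :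
    (negBetaIntegers β ∩ Set.Icc (-R) R).Finite := by
  obtain ⟨N, hN⟩ : ∃ N : ℕ, R * (β + 1) < β ^ N := pow_unbounded_of_one_lt _ hβ
  refine ((Set.finite_Iic N).biUnion fun n _ =>
    (finite_iterate_negBetaTransform_eq_zero hβ n).image fun y => (-β) ^ n * y).subset ?_
  rintro z ⟨hz, hzR⟩
  have hb : -β ≠ 0 := by linarith
  obtain ⟨n, y, hy, rfl⟩ := Set.mem_iUnion.1 hz
  rw [Set.mem_iUnion₂]
  rcases le_total n N with h | h
  · exact ⟨n, h, y, hy, rfl⟩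
  refine ⟨N, Set.self_mem_Iic, (-β) ^ n * y / (-β) ^ N,
    iterate_negBetaTransform_eq_zero_of_le hβ h ?_ ?_, ?_⟩
  · rw [mul_div_cancel_left₀ _ (pow_ne_zero n hb)]
    exact hy.2
  · rw [div_lt_div_iff₀ (by positivity) (by linarith), one_mul]
    refine lt_of_le_of_lt ?_ hN
    gcongr
    exact abs_le.2 hzR
  · exact mul_div_cancel₀ _ (pow_ne_zero N hb)

/-- Between two elements of a locally finite set there are two consecutive ones. -/
theorem exists_areConsecutive {S : Set ℝ} {x y : ℝ} (hx : x ∈ S) (hy : y ∈ S) (hxy : x < y)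
    (hfin : (S ∩ Set.Icc x y).Finite) : ∃ z, AreConsecutive S x z ∧ z ≤ y := by
  have hfin' : (S ∩ Set.Ioc x y).Finite :=
    hfin.subset (Set.inter_subset_inter_right S Set.Ioc_subset_Icc_self)
  obtain ⟨z, ⟨hzS, hxz, hzy⟩, hz⟩ :=
    hfin'.exists_minimal ⟨y, hy, hxy, le_rfl⟩
  refine ⟨z, ⟨hx, hzS, hxz, fun w hw h => ?_⟩, hzy⟩
  exact absurd (hz ⟨hw, h.1, h.2.le.trans hzy⟩ h.2.le) (not_le.2 h.2)

/-! ### Values of tails of digit sequences -/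

/-- The value `∑ⱼ d_{n+j} (-q)^{j+1}` of the `n`-th tail of the digit sequence `d` in base `-1/q`.
The inverse `q` of the base is used as parameter. -/
noncomputable def digitTail (d : ℕ → ℤ) (q : ℝ) (n : ℕ) : ℝ :=
  ∑' j : ℕ, (d (n + j) : ℝ) * (-q) ^ (j + 1)

theorem summable_digitTail {d : ℕ → ℤ} {C : ℝ} (hd : ∀ n, |(d n : ℝ)| ≤ C) {q : ℝ}
    (hq0 : 0 ≤ q) (hq1 : q < 1) (n : ℕ) :
    Summable fun j : ℕ => (d (n + j) : ℝ) * (-q) ^ (j + 1) := by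
  have h : Summable fun j : ℕ => C * (q ^ j * q) :=
    ((summable_geometric_of_lt_one hq0 hq1).mul_right q).mul_left C
  refine Summable.of_norm_bounded h fun j => ?_
  rw [Real.norm_eq_abs, abs_mul, abs_pow, abs_neg, abs_of_nonneg hq0, pow_succ]
  gcongr
  exact hd _

theorem digitTail_eq {d : ℕ → ℤ} {C : ℝ} (hd : ∀ n, |(d n : ℝ)| ≤ C) {q : ℝ}
    (hq0 : 0 ≤ q) (hq1 : q < 1) (n : ℕ) :
    digitTail d q n = -q * (d n + digitTail d q (n + 1)) := by
  rw [digitTail, (summable_digitTail hd hq0 hq1 n).tsum_eq_zero_add, digitTail, mul_add,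
    ← tsum_mul_left]
  congr 1
  · simp [mul_comm]
  · refine tsum_congr fun j => ?_
    rw [show n + (j + 1) = n + 1 + j by ring]
    ring

theorem digitTail_eq_of_zeros {d : ℕ → ℤ} {C : ℝ} (hd : ∀ n, |(d n : ℝ)| ≤ C) {q : ℝ}
    (hq0 : 0 ≤ q) (hq1 : q < 1) (n m : ℕ) (h0 : ∀ i < m, d (n + i) = 0) :
    digitTail d q n = (-q) ^ m * digitTail d q (n + m) := by
  induction m with
  | zero => simp
  | succ m ih =>
    rw [ih fun i hi => h0 i (by omega), digitTail_eq hd hq0 hq1 (n + m), h0 m (by omega)]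
    push_cast
    rw [← add_assoc]
    ring

/-- If all digits from `n` on are `0` or `1`, then the tail lies between `-(q + q³ + q⁵ + ⋯)` and
`q² + q⁴ + q⁶ + ⋯`. -/
theorem digitTail_mem_Icc {d : ℕ → ℤ} {q : ℝ} (hq0 : 0 ≤ q) (hq1 : q < 1) {n : ℕ}
    (hd0 : ∀ j, 0 ≤ d (n + j)) (hd1 : ∀ j, d (n + j) ≤ 1) :
    digitTail d q n ∈ Set.Icc (-(q / (1 - q ^ 2))) (q ^ 2 / (1 - q ^ 2)) := by
  have hd0' : ∀ j, (0 : ℝ) ≤ d (n + j) := fun j => by exact_mod_cast hd0 j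
  have hd1' : ∀ j, (d (n + j) : ℝ) ≤ 1 := fun j => by exact_mod_cast hd1 j
  have hg : HasSum (fun j : ℕ => q ^ (j + 1)) (q * (1 - q)⁻¹) := by
    simpa [pow_succ'] using (hasSum_geometric_of_lt_one hq0 hq1).mul_left q
  have hg' : HasSum (fun j : ℕ => (-q) ^ (j + 1)) (-q * (1 + q)⁻¹) := by
    have : |-q| < 1 := by rwa [abs_neg, abs_of_nonneg hq0]
    simpa [pow_succ'] using (hasSum_geometric_of_abs_lt_one this).mul_left (-q)
  have hpow : ∀ j : ℕ, |(-q) ^ (j + 1)| = q ^ (j + 1) := fun j => by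
    rw [abs_pow, abs_neg, abs_of_nonneg hq0]
  have hs : Summable fun j : ℕ => (d (n + j) : ℝ) * (-q) ^ (j + 1) := by
    refine Summable.of_norm_bounded hg.summable fun j => ?_
    rw [Real.norm_eq_abs, abs_mul, hpow, abs_of_nonneg (hd0' j)]
    exact mul_le_of_le_one_left (by positivity) (hd1' j)
  have h1 : 1 - q ≠ 0 := by linarith
  have h2 : 1 + q ≠ 0 := by linarith
  have h3 : 1 - q ^ 2 ≠ 0 := by nlinarith
  -- The positive and the negative part of `x` are `(|x| + x) / 2` and `(|x| - x) / 2`.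
  constructor
  · refine (le_of_eq ?_).trans
      (hasSum_le (fun j => ?_) ((hg'.sub hg).div_const 2) hs.hasSum)
    · field_simp
      ring
    · have := neg_abs_le ((-q) ^ (j + 1))
      rw [hpow] at this
      nlinarith [hd0' j, hd1' j, le_abs_self ((-q) ^ (j + 1)), hpow j]
  · refine (hasSum_le (fun j => ?_) hs.hasSum ((hg'.add hg).div_const 2)).trans
      (le_of_eq ?_)
    · have := neg_abs_le ((-q) ^ (j + 1))
      rw [hpow] at this
      nlinarith [hd0' j, hd1' j, le_abs_self ((-q) ^ (j + 1)), hpow j]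
    · field_simp
      ring

/-! ### The sequence `3 0 1 0³ 1 0⁵ 1 ⋯` -/

theorem growingGapDigits_zero : growingGapDigits 0 = 3 := rfl

theorem growingGapDigits_succ_mem (n : ℕ) :
    0 ≤ growingGapDigits (n + 1) ∧ growingGapDigits (n + 1) ≤ 1 := by
  unfold growingGapDigits
  rw [if_neg n.succ_ne_zero]
  split_ifs <;> simp

theorem abs_growingGapDigits_le (n : ℕ) : |(growingGapDigits n : ℝ)| ≤ 3 := by
  cases n with
  | zero => rw [growingGapDigits_zero]; norm_num
  | succ n =>
    obtain ⟨h0, h1⟩ := growingGapDigits_succ_mem n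
    rw [abs_le]
    constructor
    · have : (0 : ℝ) ≤ growingGapDigits (n + 1) := by exact_mod_cast h0
      linarith
    · have : (growingGapDigits (n + 1) : ℝ) ≤ 1 := by exact_mod_cast h1
      linarith

theorem growingGapDigits_mul_succ {k : ℕ} (hk : 1 ≤ k) : growingGapDigits (k * (k + 1)) = 1 := by
  unfold growingGapDigits
  rw [if_neg (by positivity), if_pos ⟨k, by nlinarith, rfl⟩]

theorem growingGapDigits_eq_zero {k n : ℕ} (h1 : k * (k + 1) < n)
    (h2 : n < (k + 1) * (k + 2)) : growingGapDigits n = 0 := by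
  unfold growingGapDigits
  rw [if_neg (by omega), if_neg]
  rintro ⟨i, -, rfl⟩
  have hki : k < i := by
    by_contra! h
    exact absurd h1 (not_lt.2 (by gcongr))
  exact absurd h2 (not_lt.2 (Nat.mul_le_mul hki (by omega)))

theorem growingGap_tail_mem_Icc {q : ℝ} (hq0 : 0 ≤ q) (hq : q ≤ 1 / 3) {n : ℕ} (hn : 1 ≤ n) :
    digitTail growingGapDigits q n ∈ Set.Icc (-(3 / 8) : ℝ) (1 / 8) := by
  obtain ⟨m, rfl⟩ := Nat.exists_eq_add_of_le' hn
  obtain ⟨h1, h2⟩ := digitTail_mem_Icc (n := m + 1) hq0 (by linarith : q < 1)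
    (fun j => add_right_comm m 1 j ▸ (growingGapDigits_succ_mem (m + j)).1)
    (fun j => add_right_comm m 1 j ▸ (growingGapDigits_succ_mem (m + j)).2)
  have h3 : 0 < 1 - q ^ 2 := by nlinarith
  refine ⟨le_trans ?_ h1, h2.trans ?_⟩
  · rw [neg_le_neg_iff, div_le_iff₀ h3]
    nlinarith
  · rw [div_le_iff₀ h3]
    nlinarith

/-- For `1/q = β` the equation says that `growingGapDigits` represents `-β/(β+1)` in base `-β`. -/
theorem exists_digitTail_zero_eq :
    ∃ q ∈ Set.Icc (1 / 4 : ℝ) (1 / 3), digitTail growingGapDigits q 0 = -(1 / (1 + q)) := by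
  have hcont : ContinuousOn (fun q => digitTail growingGapDigits q 0 + 1 / (1 + q))
      (Set.Icc (1 / 4 : ℝ) (1 / 3)) := by
    refine ContinuousOn.add ?_ ?_
    · unfold digitTail
      refine continuousOn_tsum (u := fun j : ℕ => 3 * (1 / 3 : ℝ) ^ (j + 1)) (fun j => by fun_prop)
        (((summable_nat_add_iff 1).2
          (summable_geometric_of_lt_one (by norm_num) (by norm_num))).mul_left 3) ?_
      rintro j q ⟨hq1, hq2⟩
      have hq0 : 0 ≤ q := by linarith
      rw [Real.norm_eq_abs, abs_mul, abs_pow, abs_neg, abs_of_nonneg hq0]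
      gcongr
      exact abs_growingGapDigits_le _
    · refine continuousOn_const.div (by fun_prop) ?_
      rintro q ⟨hq1, -⟩
      linarith
  have heq : ∀ q : ℝ, 0 ≤ q → q < 1 → digitTail growingGapDigits q 0
      = -q * (3 + digitTail growingGapDigits q 1) := by
    intro q hq0 hq1
    rw [digitTail_eq abs_growingGapDigits_le hq0 hq1, growingGapDigits_zero]
    norm_num
  obtain ⟨q, hq, h⟩ := intermediate_value_Icc' (by norm_num) hcont
    (show (0 : ℝ) ∈ _ from by
      constructor
      · have := (growingGap_tail_mem_Icc (q := 1 / 3) (by norm_num) le_rfl le_rfl).1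
        rw [heq _ (by norm_num) (by norm_num)]
        norm_num
        linarith
      · have := (growingGap_tail_mem_Icc (q := 1 / 4) (by norm_num) (by norm_num) le_rfl).2
        rw [heq _ (by norm_num) (by norm_num)]
        norm_num
        linarith)
  exact ⟨q, hq, by simp only at h; linarith⟩

/-- The tail that starts directly behind the digit `1` at index `k(k+1)` begins with `2k + 1`
zeros followed by a `1`. -/
theorem growingGap_tail_after_one {q : ℝ} (hq0 : 0 < q) (hq : q ≤ 1 / 3) (k : ℕ) :
    0 < digitTail growingGapDigits q (k * (k + 1) + 1) ∧
      digitTail growingGapDigits q (k * (k + 1) + 1) ≤ 2 * q ^ (2 * k + 2) := by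
  have hidx : k * (k + 1) + 1 + (2 * k + 1) = (k + 1) * (k + 1 + 1) := by ring
  obtain ⟨h1, h2⟩ := growingGap_tail_mem_Icc hq0.le hq
    (Nat.le_add_left 1 ((k + 1) * (k + 1 + 1)))
  rw [digitTail_eq_of_zeros abs_growingGapDigits_le hq0.le (by linarith) _ (2 * k + 1)
    fun i hi => growingGapDigits_eq_zero (k := k) (by omega) (by nlinarith), hidx,
    digitTail_eq abs_growingGapDigits_le hq0.le (by linarith),
    growingGapDigits_mul_succ (Nat.le_add_left 1 k), Odd.neg_pow ⟨k, rfl⟩]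
  set t := digitTail growingGapDigits q ((k + 1) * (k + 1 + 1) + 1)
  have h3 : 0 < q ^ (2 * k + 2) := by positivity
  rw [show -q ^ (2 * k + 1) * (-q * (((1 : ℤ) : ℝ) + t)) = q ^ (2 * k + 2) * (1 + t) by
    push_cast; ring]
  constructor
  · exact mul_pos h3 (by linarith)
  · nlinarith

/-! ### The base and its close integers -/

theorem Icc_subset_negBetaDomain {β : ℝ} (h3 : 3 ≤ β) (h4 : β ≤ 4) :
    Set.Icc (-(1 / 2) : ℝ) (3 / 16) ⊆ negBetaDomain β := by
  rintro x ⟨h1, h2⟩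
  constructor
  · rw [div_le_iff₀ (by linarith)]
    nlinarith
  · rw [lt_div_iff₀ (by linarith)]
    nlinarith

theorem digitTail_succ_eq {β : ℝ} (h3 : 3 ≤ β) (n : ℕ) :
    digitTail growingGapDigits β⁻¹ (n + 1)
      = -β * digitTail growingGapDigits β⁻¹ n - growingGapDigits n := by
  have hβ : β ≠ 0 := by linarith
  rw [digitTail_eq abs_growingGapDigits_le (inv_nonneg.2 (by linarith))
    (inv_lt_one_of_one_lt₀ (by linarith)) n]
  field_simp
  ring

theorem inv_le_third {β : ℝ} (h3 : 3 ≤ β) : β⁻¹ ≤ 1 / 3 := by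
  rw [one_div]
  exact inv_anti₀ (by norm_num) h3

theorem negBetaExpansion_eq_growingGapDigits {β : ℝ} (h3 : 3 ≤ β) (h4 : β ≤ 4)
    (h : digitTail growingGapDigits β⁻¹ 0 = -β / (β + 1)) :
    negBetaExpansion β (-β / (β + 1)) = growingGapDigits := by
  have hq0 : 0 ≤ β⁻¹ := inv_nonneg.2 (by linarith)
  have hmem : ∀ i, 1 ≤ i → digitTail growingGapDigits β⁻¹ i ∈ negBetaDomain β := fun i hi =>
    Icc_subset_negBetaDomain h3 h4
      (Set.Icc_subset_Icc (by norm_num) (by norm_num)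
        (growingGap_tail_mem_Icc hq0 (inv_le_third h3) hi))
  funext n
  rw [negBetaExpansion, ← h, iterate_negBetaTransform_eq (by linarith)
    (fun i hi _ => hmem i hi) fun i _ => digitTail_succ_eq h3 i]
  exact floor_eq_of_mem_negBetaDomain (by linarith) (hmem (n + 1) (by omega))
    (digitTail_succ_eq h3 n)

/-- The value `s = ℓ - (-β)^{-n} tₙ` of the first `n` digits lies in the interior of the domain
and is sent to `0` by `Tⁿ`, for `n = k(k+1) + 1`. Along the orbit it differs from the tails by at
most `tₙ`; at the starting point, where there is no room to the left of `ℓ`, the sign of `(-β)^n`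
for odd `n` is what matters. -/
theorem exists_iterate_negBetaTransform_eq_zero {β : ℝ} (h3 : 3 ≤ β) (h4 : β ≤ 4)
    (h : digitTail growingGapDigits β⁻¹ 0 = -β / (β + 1)) {k n : ℕ} (hk : 1 ≤ k)
    (hn : n = k * (k + 1) + 1) :
    ∃ s : ℝ, -β / (β + 1) < s ∧ s ≤ 0 ∧ (negBetaTransform β)^[n] s = 0 ∧
      (-β) ^ n * (-β / (β + 1) - s) = digitTail growingGapDigits β⁻¹ n := by
  have hβ : -β ≠ 0 := by linarith
  have hq0 : 0 < β⁻¹ := inv_pos.2 (by linarith)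
  have hodd : Odd n := hn ▸ (Nat.even_mul_succ_self k).add_one
  obtain ⟨ht0, ht1⟩ := growingGap_tail_after_one hq0 (inv_le_third h3) k
  rw [← hn] at ht0 ht1
  set t := digitTail growingGapDigits β⁻¹ with ht
  have htn : t n ≤ 1 / 16 := by
    have h1 : β⁻¹ ^ (2 * k + 2) ≤ β⁻¹ ^ 4 :=
      pow_le_pow_of_le_one hq0.le (by linarith [inv_le_third h3]) (by omega)
    have h2 : β⁻¹ ^ 4 ≤ (1 / 3) ^ 4 := by
      gcongr
      exact inv_le_third h3
    norm_num [-inv_pow] at h2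
    linarith
  have hsmall : ∀ m : ℕ, |t n / (-β) ^ m| ≤ 1 / 16 := by
    intro m
    rw [abs_div, abs_pow, abs_neg, abs_of_pos ht0, abs_of_pos (by linarith : 0 < β)]
    exact (div_le_self ht0.le (one_le_pow₀ (by linarith))).trans htn
  -- The orbit of `s`; its value at `i = n` is `0`.
  let v : ℕ → ℝ := fun i => t i - t n / (-β) ^ (n - i)
  have hmem : ∀ i, 1 ≤ i → v i ∈ negBetaDomain β := by
    intro i hi
    refine Icc_subset_negBetaDomain h3 h4 ?_
    obtain ⟨h1, h2⟩ := growingGap_tail_mem_Icc hq0.le (inv_le_third h3) hi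
    have h5 := abs_le.1 (hsmall (n - i))
    constructor <;> simp only [v, ht] at * <;> linarith
  have horb : (negBetaTransform β)^[n] (v 0) = v n := by
    refine iterate_negBetaTransform_eq (d := growingGapDigits) (by linarith)
      (fun i hi _ => hmem i hi) fun i hi => ?_
    simp only [v]
    rw [ht, digitTail_succ_eq h3 i, show n - i = n - (i + 1) + 1 by omega, pow_succ]
    field_simp
    ring
  have hl : -β / (β + 1) ≤ -(1 / 16) := by
    rw [div_le_iff₀ (by linarith)]
    linarith
  have hv0 : v 0 = -β / (β + 1) - t n / (-β) ^ n := by simp only [v, h, Nat.sub_zero]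
  refine ⟨v 0, ?_, ?_, ?_, ?_⟩
  · have : t n / (-β) ^ n < 0 := div_neg_of_pos_of_neg ht0 (hodd.pow_neg (by linarith))
    linarith
  · have := (abs_le.1 (hsmall n)).1
    linarith
  · rw [horb]
    simp [v]
  · rw [hv0, sub_sub_cancel, mul_div_cancel₀ _ (pow_ne_zero n hβ)]

/-- A point `s` in the interior of the domain with `Tⁿ s = 0` produces two `(-β)`-integers: the
points `-(1 + s)/β` and `s/β²` on the two sides of the discontinuity of `T` at `-1/(β(β+1))` are
sent to `s` by `T` and by `T²`. -/
theorem mem_negBetaIntegers_of_iterate_eq_zero {β s : ℝ} (hβ : 2 ≤ β) (hs : -β / (β + 1) < s)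
    (hs0 : s ≤ 0) {n : ℕ} (h : (negBetaTransform β)^[n] s = 0) :
    (-β) ^ (n + 2) * (-(1 + s) / β) ∈ negBetaIntegers β ∧
      (-β) ^ (n + 2) * (s / β ^ 2) ∈ negBetaIntegers β := by
  have hβ0 : 0 < β := by linarith
  have hdom : ∀ x : ℝ, -β / (β + 1) ≤ x → x ≤ 0 → x ∈ negBetaDomain β := fun x h1 h2 =>
    ⟨h1, h2.trans_lt (by positivity)⟩
  have hsd := hdom s hs.le hs0
  have hlt : -β < s * (β + 1) := (div_lt_iff₀ (by linarith)).1 hs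
  have hT0 : negBetaTransform β 0 = 0 :=
    negBetaTransform_eq_of_mem (d := 0) hβ0
      (hdom 0 (div_nonpos_of_nonpos_of_nonneg (by linarith) (by linarith)) le_rfl) (by simp)
  constructor
  · refine Set.mem_iUnion.2 ⟨n + 2, _, ⟨hdom _ ?_ ?_, ?_⟩, rfl⟩
    · rw [div_le_div_iff₀ (by linarith) hβ0]
      nlinarith
    · refine div_nonpos_of_nonpos_of_nonneg ?_ hβ0.le
      nlinarith
    · rw [Function.iterate_succ_apply, negBetaTransform_eq_of_mem (d := 1) hβ0 hsd
        (by field_simp; push_cast; ring), Function.iterate_succ_apply', h, hT0]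
  · have h1 : -s / β ∈ negBetaDomain β := by
      constructor
      · rw [div_le_div_iff₀ (by linarith) hβ0]
        nlinarith
      · rw [div_lt_div_iff₀ hβ0 (by linarith)]
        linarith
    refine Set.mem_iUnion.2 ⟨n + 2, _, ⟨hdom _ ?_ ?_, ?_⟩, rfl⟩
    · rw [div_le_div_iff₀ (by linarith) (by positivity)]
      nlinarith
    · exact div_nonpos_of_nonpos_of_nonneg hs0 (by positivity)
    · rw [Function.iterate_succ_apply, negBetaTransform_eq_of_mem (d := 0) hβ0 h1
        (by field_simp; simp), Function.iterate_succ_apply,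
        negBetaTransform_eq_of_mem (d := 0) hβ0 hsd (by field_simp; simp), h]

theorem exists_negBetaIntegers_close {β : ℝ} (h3 : 3 ≤ β) (h4 : β ≤ 4)
    (h : digitTail growingGapDigits β⁻¹ 0 = -β / (β + 1)) {ε : ℝ} (hε : 0 < ε) :
    ∃ x ∈ negBetaIntegers β, ∃ y ∈ negBetaIntegers β, x < y ∧ y - x < ε := by
  have hq0 : 0 < β⁻¹ := inv_pos.2 (by linarith)
  have hq1 : β⁻¹ < 1 := inv_lt_one_of_one_lt₀ (by linarith)
  obtain ⟨k, hk⟩ := exists_pow_lt_of_lt_one (by positivity : 0 < ε / 10) hq1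
  obtain ⟨ht0, ht1⟩ := growingGap_tail_after_one hq0 (inv_le_third h3) (k + 1)
  obtain ⟨s, hs, hs0, hT, hst⟩ := exists_iterate_negBetaTransform_eq_zero h3 h4 h
    (Nat.le_add_left 1 k) rfl
  obtain ⟨hy, hx⟩ := mem_negBetaIntegers_of_iterate_eq_zero (by linarith) hs hs0 hT
  have hpow : β⁻¹ ^ (2 * (k + 1) + 2) ≤ β⁻¹ ^ k :=
    pow_le_pow_of_le_one hq0.le hq1.le (by omega)
  have hdiff : (-β) ^ ((k + 1) * (k + 1 + 1) + 1 + 2) * (-(1 + s) / β)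
      - (-β) ^ ((k + 1) * (k + 1 + 1) + 1 + 2) * (s / β ^ 2)
      = (β + 1) * digitTail growingGapDigits β⁻¹ ((k + 1) * (k + 1 + 1) + 1) := by
    rw [← hst, pow_add _ _ 2]
    have h1 : β ≠ 0 := by linarith
    have h2 : β + 1 ≠ 0 := by linarith
    field_simp
    ring
  refine ⟨_, hx, _, hy, ?_, ?_⟩
  · rw [← sub_pos, hdiff]
    exact mul_pos (by linarith) ht0
  · rw [hdiff]
    nlinarith

theorem mainTheorem3 :
    ∃ β : ℝ, 1 < β ∧
      negBetaExpansion β (-β / (β + 1)) = growingGapDigits ∧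
      ¬ IsUniformlyDiscrete (negBetaIntegers β) ∧
      ∀ ε : ℝ, 0 < ε → ∃ x y : ℝ, AreConsecutive (negBetaIntegers β) x y ∧ y - x < ε := by
  obtain ⟨q, ⟨hq1, hq2⟩, hq⟩ := exists_digitTail_zero_eq
  have hq0 : 0 < q := by linarith
  have h3 : 3 ≤ q⁻¹ := by
    rw [le_inv_comm₀ (by norm_num) hq0]
    linarith
  have h4 : q⁻¹ ≤ 4 := by
    rw [inv_le_comm₀ hq0 (by norm_num)]
    linarith
  have h : digitTail growingGapDigits q⁻¹⁻¹ 0 = -q⁻¹ / (q⁻¹ + 1) := by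
    rw [inv_inv, hq]
    field_simp
  refine ⟨q⁻¹, by linarith, negBetaExpansion_eq_growingGapDigits h3 h4 h, ?_, fun ε hε => ?_⟩
  · rintro ⟨r, hr, hS⟩
    obtain ⟨x, hx, y, hy, hxy, hlt⟩ := exists_negBetaIntegers_close h3 h4 h hr
    exact hxy.ne (hS x ⟨hx, le_rfl, by linarith⟩ ⟨hy, hxy.le, by linarith⟩)
  · obtain ⟨x, hx, y, hy, hxy, hlt⟩ := exists_negBetaIntegers_close h3 h4 h hε
    obtain ⟨z, hz, hzy⟩ := exists_areConsecutive hx hy hxy <|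
      (finite_negBetaIntegers_inter_Icc (by linarith : 1 < q⁻¹) (max |x| |y|)).subset <|
        Set.inter_subset_inter_right _ <| Set.Icc_subset_Icc
          (neg_le.1 ((neg_le_abs x).trans (le_max_left _ _)))
          ((le_abs_self y).trans (le_max_right _ _))
    exact ⟨x, z, hz, by linarith⟩
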